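/- Let $q,k$ be non-negative integers, let $\mathrm{M}_n$ denote the algebra of complex $n\times n$ matrices with identity $\mathbb{1}_n$ and Frobenius inner product $\langle A,B\rangle=\operatorname{tr}(A^\ast B)$. For a unital $*$-subalgebra $\mathcal R$ of $\mathrm{M}_n$, let $\mathcal{D}(\mathcal{R})$ be the set of all hermitian $\rho\in\mathcal{R}$ such that $\operatorname{tr}(\rho)=1$ and $\langle\rho,B\rangle\ge 0$ for every positive semidefinite $B\in\mathcal{R}$, with the relative topology. If $\mathcal{R}_2\subset\mathcal{R}_1$ are unital $*$-subalgebras of $\mathrm{M}_n$, the orthogonal projection $\mathcal{D}(\mathcal{R}_1)\to\mathcal{D}(\mathcal{R}_2)$ is the restriction of the orthogonal projection $\pi:\mathcal{R}_1\to\mathcal{R}_2$, which is given by $\pi(A)\in\mathcal{R}_2$ and $\langle A-\pi(A),B\rangle=0$ for all $B\in\mathcal{R}_2$. Let $\bigoplus_{i=1}^k\mathrm{M}_q\subset\mathrm{M}_{kq}$ be the $*$-subalgebra of block diagonal matrices with $k$ diagonal blocks of size $q\times q$, and let $\mathrm{M}_q\otimes\mathbb{1}_k$ be its $*$-subalgebra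 of block diagonal matrices with $k$ equal blocks. Then the orthogonal projection $$\mathcal{D}\Big(\bigoplus_{i=1}^k\mathrm{M}_q\Big)\to\mathcal{D}(\mathrm{M}_q\otimes\mathbb{1}_k)$$ is open, that is, it maps open subsets of its domain to open subsets of its codomain. -/

import Mathlib

open scoped ComplexOrder Matrix Kronecker

namespace MatrixState

noncomputable section

section General

variable {ι : Type*} [Fintype ι]

/-- The Frobenius inner product `⟨A, B⟩ = tr (A⋆ B)` of complex matrices. -/
def frob (A B : Matrix ι ι ℂ) : ℂ := (Aᴴ * B).trace

/-- The linear identification of matrices with vectors of entries, which carries the Frobenius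
inner product to the standard inner product (`inner_entries` below). -/
def entries : Matrix ι ι ℂ ≃ₗ[ℂ] EuclideanSpace ℂ (ι × ι) :=
  (LinearEquiv.curry ℂ ℂ ι ι).symm.trans (WithLp.linearEquiv 2 ℂ (ι × ι → ℂ)).symm

theorem inner_entries (A B : Matrix ι ι ℂ) :
    inner ℂ (entries A) (entries B) = frob A B := by
  simp only [frob, Matrix.trace, Matrix.diag, Matrix.mul_apply, Matrix.conjTranspose_apply,
    PiLp.inner_apply, Fintype.sum_prod_type]
  rw [Finset.sum_comm]
  refine Finset.sum_congr rfl fun i _ => Finset.sum_congr rfl fun j _ => ?_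
  change (inner ℂ (A j i) (B j i) : ℂ) = _
  simp [mul_comm]

variable [DecidableEq ι]

/-- The positive cone `C(R)`: the positive semidefinite matrices in the (unital, complex)
star-subalgebra `R` of the full matrix algebra. -/
def posCone (R : StarSubalgebra ℂ (Matrix ι ι ℂ)) : Set (Matrix ι ι ℂ) :=
  {A | A ∈ R ∧ A.PosSemidef}

/-- The space `H(R)` of hermitian matrices in `R`. -/
def hermitianPart (R : StarSubalgebra ℂ (Matrix ι ι ℂ)) : Set (Matrix ι ι ℂ) :=
  {A | A ∈ R ∧ A.IsHermitian}

/-- The dual cone `C(R)^∨` of the positive cone, taken inside the hermitian matrices of `R`. -/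
def dualCone (R : StarSubalgebra ℂ (Matrix ι ι ℂ)) : Set (Matrix ι ι ℂ) :=
  {A | A ∈ hermitianPart R ∧ ∀ B ∈ posCone R, 0 ≤ frob A B}

/-- The set `D(R)` of density matrices of `R`, with the relative topology (as a subtype). -/
def density (R : StarSubalgebra ℂ (Matrix ι ι ℂ)) : Set (Matrix ι ι ℂ) :=
  {A | A ∈ dualCone R ∧ A.trace = 1}

/-- The orthogonal projection of the full matrix algebra onto `R` with respect to the Frobenius
inner product. Its restriction to a star-subalgebra containing `R` is the orthogonal projection of
that subalgebra onto `R`. -/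
def orthProj (R : StarSubalgebra ℂ (Matrix ι ι ℂ)) : Matrix ι ι ℂ →ₗ[ℂ] Matrix ι ι ℂ :=
  entries.symm.toLinearMap ∘ₗ
    ((R.toSubalgebra.toSubmodule.map entries.toLinearMap).starProjection).toLinearMap ∘ₗ
      entries.toLinearMap

theorem orthProj_mem (R : StarSubalgebra ℂ (Matrix ι ι ℂ)) (A : Matrix ι ι ℂ) :
    orthProj R A ∈ R := by
  obtain ⟨B, hB, h⟩ := Submodule.starProjection_apply_mem
    (R.toSubalgebra.toSubmodule.map (entries (ι := ι)).toLinearMap) (entries A)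
  have : orthProj R A = B := by
    change entries.symm _ = B
    rw [LinearEquiv.symm_apply_eq]
    exact h.symm
  rw [this]
  exact hB

theorem frob_sub_orthProj (R : StarSubalgebra ℂ (Matrix ι ι ℂ)) (A : Matrix ι ι ℂ)
    {B : Matrix ι ι ℂ} (hB : B ∈ R) : frob (A - orthProj R A) B = 0 := by
  have h := Submodule.starProjection_inner_eq_zero
    (K := R.toSubalgebra.toSubmodule.map (entries (ι := ι)).toLinearMap) (entries A) (entries B)
    (Submodule.mem_map_of_mem (f := (entries (ι := ι)).toLinearMap) hB)
  rw [← inner_entries, map_sub]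
  have h2 : entries (orthProj R A) = _ := entries.apply_symm_apply _
  rw [h2]
  exact h

theorem frob_orthProj (R : StarSubalgebra ℂ (Matrix ι ι ℂ)) (A : Matrix ι ι ℂ)
    {B : Matrix ι ι ℂ} (hB : B ∈ R) : frob (orthProj R A) B = frob A B := by
  have h := frob_sub_orthProj R A hB
  simp only [frob, Matrix.conjTranspose_sub, Matrix.sub_mul, Matrix.trace_sub] at h ⊢
  exact (sub_eq_zero.1 h).symm

/-- The characterization of the orthogonal projection: `orthProj R A` is the only element `P` of
`R` with `⟨A - P, B⟩ = 0` for all `B ∈ R`. -/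
theorem eq_orthProj (R : StarSubalgebra ℂ (Matrix ι ι ℂ)) {A P : Matrix ι ι ℂ} (hP : P ∈ R)
    (h : ∀ B ∈ R, frob (A - P) B = 0) : P = orthProj R A := by
  have hm : P - orthProj R A ∈ R := sub_mem hP (orthProj_mem R A)
  have h0 : frob (P - orthProj R A) (P - orthProj R A) = 0 := by
    have h1 := h _ hm
    have h2 := frob_sub_orthProj R A hm
    set D := P - orthProj R A with hD
    have : D = (A - orthProj R A) - (A - P) := by rw [hD]; abel
    have h3 : frob D D = frob (A - orthProj R A) D - frob (A - P) D := by
      conv_lhs => arg 1; rw [this]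
      simp [frob, Matrix.sub_mul]
    rw [h3, h1, h2, sub_zero]
  exact sub_eq_zero.1 (Matrix.trace_conjTranspose_mul_self_eq_zero_iff.1 h0)

/-- If `R₂ ⊆ R₁`, then the orthogonal projection maps `D(R₁)` into `D(R₂)`. -/
theorem orthProj_mem_density {R₁ R₂ : StarSubalgebra ℂ (Matrix ι ι ℂ)} (h : R₂ ≤ R₁)
    {A : Matrix ι ι ℂ} (hA : A ∈ density R₁) : orthProj R₂ A ∈ density R₂ := by
  obtain ⟨⟨⟨_, hAh⟩, hpos⟩, htr⟩ := hA
  refine ⟨⟨⟨orthProj_mem R₂ A, ?_⟩, fun B hB => ?_⟩, ?_⟩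
  · refine eq_orthProj R₂ (star_mem (orthProj_mem R₂ A)) fun B hB => ?_
    have h1 := frob_sub_orthProj R₂ A (star_mem hB)
    have h2 := congrArg star h1
    rw [frob, ← Matrix.trace_conjTranspose] at h2
    simpa [frob, hAh.eq, Matrix.star_eq_conjTranspose, Matrix.trace_mul_comm B] using h2
  · rw [frob_orthProj R₂ A hB.1]
    exact hpos B ⟨h hB.1, hB.2⟩
  · have h1 := congrArg star (frob_orthProj R₂ A (one_mem R₂))
    simp only [frob, mul_one, Matrix.trace_conjTranspose, star_star] at h1
    rw [h1, htr]

/-- The orthogonal projection `D(R₁) → D(R₂)` for `R₂ ⊆ R₁`: the restriction of the orthogonal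
projection `R₁ → R₂` to density matrices. -/
def densityProj {R₁ R₂ : StarSubalgebra ℂ (Matrix ι ι ℂ)} (h : R₂ ≤ R₁) :
    density R₁ → density R₂ :=
  fun A => ⟨orthProj R₂ A.1, orthProj_mem_density h A.2⟩

end General

/-- The star-subalgebra `M_q ⊕ ⋯ ⊕ M_q` (`k` summands) of `M_{kq}`: the block diagonal matrices
with `k` diagonal blocks of size `q`. The index `(i, j)` is the `i`-th position in block `j`. -/
def directSumAlg (q k : ℕ) : StarSubalgebra ℂ (Matrix (Fin q × Fin k) (Fin q × Fin k) ℂ) where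
  carrier := {M | ∃ A : Fin k → Matrix (Fin q) (Fin q) ℂ, M = Matrix.blockDiagonal A}
  mul_mem' := by
    rintro _ _ ⟨A, rfl⟩ ⟨B, rfl⟩
    exact ⟨fun j => A j * B j, (Matrix.blockDiagonal_mul A B).symm⟩
  add_mem' := by
    rintro _ _ ⟨A, rfl⟩ ⟨B, rfl⟩
    exact ⟨A + B, (Matrix.blockDiagonal_add A B).symm⟩
  algebraMap_mem' := fun c => ⟨c • 1, by
    rw [Matrix.blockDiagonal_smul, Matrix.blockDiagonal_one, Algebra.algebraMap_eq_smul_one]⟩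
  star_mem' := by
    rintro _ ⟨A, rfl⟩
    exact ⟨fun j => (A j)ᴴ, Matrix.blockDiagonal_conjTranspose A⟩

/-- The star-subalgebra `M_q ⊗ 1_k` of `M_{kq}`: all Kronecker products `A ⊗ 1_k`. -/
def tensorOneAlg (q k : ℕ) : StarSubalgebra ℂ (Matrix (Fin q × Fin k) (Fin q × Fin k) ℂ) where
  carrier := {M | ∃ A : Matrix (Fin q) (Fin q) ℂ, M = A ⊗ₖ (1 : Matrix (Fin k) (Fin k) ℂ)}
  mul_mem' := by
    rintro _ _ ⟨A, rfl⟩ ⟨B, rfl⟩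
    exact ⟨A * B, by rw [← Matrix.mul_kronecker_mul, mul_one]⟩
  add_mem' := by
    rintro _ _ ⟨A, rfl⟩ ⟨B, rfl⟩
    exact ⟨A + B, (Matrix.add_kronecker A B 1).symm⟩
  algebraMap_mem' := fun c => ⟨c • 1, by
    rw [Matrix.smul_kronecker, Matrix.one_kronecker_one, Algebra.algebraMap_eq_smul_one]⟩
  star_mem' := by
    rintro _ ⟨A, rfl⟩
    exact ⟨Aᴴ, by
      rw [Matrix.star_eq_conjTranspose, Matrix.conjTranspose_kronecker,
        Matrix.conjTranspose_one]⟩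

/-- `M_q ⊗ 1_k` consists of the block diagonal matrices with `k` equal blocks, so it is contained
in `M_q ⊕ ⋯ ⊕ M_q`. -/
theorem tensorOneAlg_le (q k : ℕ) : tensorOneAlg q k ≤ directSumAlg q k := by
  rintro _ ⟨A, rfl⟩
  exact ⟨fun _ => A, Matrix.kronecker_one A⟩

end

end MatrixState

namespace MatrixState

open Matrix

/-! ### Square roots and decompositions of positive semidefinite matrices. -/

section SquareRoot

variable {ι : Type*} [Fintype ι] [DecidableEq ι]

/-! In terms of blocks, the projection replaces `A₁, …, A_k` by their average, so it records only
the sum `S`. It is open because a continuous section passes through every point of its domain. By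
`exists_resolution_of_sum`, `A_j = √S E_j √S` with `E_j` positive semidefinite and summing to `1`.
Freezing the `E_j` and letting the sum `T` vary, the blocks `√T E_j √T` are positive semidefinite
and add up to `T`. They depend continuously on `T`, even where the rank drops, by
`continuousOn_cfc_sqrt`. -/

open scoped Matrix.Norms.L2Operator in
theorem continuousOn_cfc_sqrt :
    ContinuousOn (fun A : Matrix ι ι ℂ => cfc Real.sqrt A) {A | A.IsHermitian} :=
  continuousOn_id.cfc_of_mem_nhdsSet (s := Set.univ) Real.sqrt
    (fun _ _ => Filter.univ_mem) (fun _ hA => hA) Real.continuous_sqrt.continuousOn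

/-- The spectrum is finite, so the calculus also applies to functions such as `x ↦ (√x)⁻¹`,
discontinuous at `0`. -/
theorem continuousOn_spectrum (f : ℝ → ℝ) (A : Matrix ι ι ℂ) :
    ContinuousOn f (spectrum ℝ A) :=
  (Matrix.finite_real_spectrum (A := A)).continuousOn f

theorem isHermitian_cfc (f : ℝ → ℝ) (A : Matrix ι ι ℂ) : (cfc f A).IsHermitian :=
  cfc_predicate f A

theorem cfc_sqrt_mul_self {S : Matrix ι ι ℂ} (hS : S.PosSemidef) :
    cfc Real.sqrt S * cfc Real.sqrt S = S := by
  rw [← cfc_mul _ _ S (continuousOn_spectrum _ S) (continuousOn_spectrum _ S)]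
  conv_rhs => rw [← cfc_id ℝ S hS.1]
  refine cfc_congr fun x hx => ?_
  rw [hS.1.spectrum_real_eq_range_eigenvalues] at hx
  obtain ⟨i, rfl⟩ := hx
  exact Real.mul_self_sqrt (hS.eigenvalues_nonneg i)

/-- The Moore-Penrose inverse of the square root of a positive semidefinite matrix. -/
noncomputable def pinvSqrt (S : Matrix ι ι ℂ) : Matrix ι ι ℂ :=
  -- The convention `0⁻¹ = 0` makes this vanish on the kernel of `S`.
  cfc (fun x => (Real.sqrt x)⁻¹) S

/-- The orthogonal projection onto the range of a positive semidefinite matrix. -/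
noncomputable def support (S : Matrix ι ι ℂ) : Matrix ι ι ℂ :=
  cfc (fun x => Real.sqrt x * (Real.sqrt x)⁻¹) S

theorem isHermitian_pinvSqrt (S : Matrix ι ι ℂ) : (pinvSqrt S).IsHermitian :=
  isHermitian_cfc _ S

theorem isHermitian_support (S : Matrix ι ι ℂ) : (support S).IsHermitian :=
  isHermitian_cfc _ S

theorem sqrt_mul_pinvSqrt (S : Matrix ι ι ℂ) : cfc Real.sqrt S * pinvSqrt S = support S :=
  (cfc_mul _ _ S (continuousOn_spectrum _ S) (continuousOn_spectrum _ S)).symm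

theorem pinvSqrt_mul_sqrt (S : Matrix ι ι ℂ) : pinvSqrt S * cfc Real.sqrt S = support S := by
  have h := congrArg conjTranspose (sqrt_mul_pinvSqrt S)
  rwa [conjTranspose_mul, (isHermitian_pinvSqrt S).eq, (isHermitian_cfc _ S).eq,
    (isHermitian_support S).eq] at h

theorem sqrt_mul_support (S : Matrix ι ι ℂ) : cfc Real.sqrt S * support S = cfc Real.sqrt S := by
  rw [support, ← cfc_mul _ _ S (continuousOn_spectrum _ S) (continuousOn_spectrum _ S)]
  refine cfc_congr fun x _ => ?_
  by_cases h : Real.sqrt x = 0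
  · simp [h]
  · field_simp

theorem support_mul_self (S : Matrix ι ι ℂ) : support S * support S = support S := by
  nth_rw 1 [← pinvSqrt_mul_sqrt]
  rw [mul_assoc, sqrt_mul_support, pinvSqrt_mul_sqrt]

theorem mul_support {S : Matrix ι ι ℂ} (hS : S.PosSemidef) : S * support S = S := by
  nth_rw 1 [← cfc_sqrt_mul_self hS]
  rw [mul_assoc, sqrt_mul_support, cfc_sqrt_mul_self hS]

theorem posSemidef_one_sub_support (S : Matrix ι ι ℂ) : (1 - support S).PosSemidef := by
  have h := posSemidef_conjTranspose_mul_self (1 - support S)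
  rwa [conjTranspose_sub, conjTranspose_one, (isHermitian_support S).eq, sub_mul, one_mul,
    mul_sub, mul_one, support_mul_self, sub_self, sub_zero] at h

/-- A summand of a sum of positive semidefinite matrices annihilates what the sum annihilates. -/
theorem mul_eq_zero_of_sum_mul_eq_zero {κ : Type*} [Fintype κ] {A : κ → Matrix ι ι ℂ}
    (hA : ∀ j, (A j).PosSemidef) {Q : Matrix ι ι ℂ} (hQ : (∑ j, A j) * Q = 0) (j : κ) :
    A j * Q = 0 := by
  have hpos : ∀ i, (Qᴴ * A i * Q).PosSemidef := fun i => (hA i).conjTranspose_mul_mul_same Q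
  have hsum : ∑ i, (Qᴴ * A i * Q).trace = 0 := by
    rw [← trace_sum, ← Finset.sum_mul, ← Finset.mul_sum, mul_assoc, hQ, mul_zero, trace_zero]
  -- Nonnegative traces with sum zero all vanish.
  have h0 : Qᴴ * A j * Q = 0 := (hpos j).trace_eq_zero_iff.1
    ((Finset.sum_eq_zero_iff_of_nonneg fun i _ => (hpos i).trace_nonneg).1 hsum j
      (Finset.mem_univ j))
  rw [← cfc_sqrt_mul_self (hA j)] at h0 ⊢
  set R := cfc Real.sqrt (A j)
  have hR : Rᴴ = R := isHermitian_cfc _ _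
  have h1 : (R * Q)ᴴ * (R * Q) = 0 := by
    rw [conjTranspose_mul, hR, ← h0]
    simp only [mul_assoc]
  rw [mul_assoc, conjTranspose_mul_self_eq_zero.1 h1, mul_zero]

/-- Every decomposition of a positive semidefinite matrix `S` as a finite sum of positive
semidefinite matrices is obtained from a resolution of the identity by conjugation with the square
root of `S`. -/
theorem exists_resolution_of_sum {κ : Type*} [Fintype κ] [Nonempty κ] {A : κ → Matrix ι ι ℂ}
    (hA : ∀ j, (A j).PosSemidef) :
    ∃ E : κ → Matrix ι ι ℂ, (∀ j, (E j).PosSemidef) ∧ ∑ j, E j = 1 ∧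
      ∀ j, cfc Real.sqrt (∑ i, A i) * E j * cfc Real.sqrt (∑ i, A i) = A j := by
  set S := ∑ i, A i with hSdef
  have hS : S.PosSemidef := posSemidef_sum _ fun i _ => hA i
  have hk : (Fintype.card κ : ℂ) ≠ 0 := Nat.cast_ne_zero.2 Fintype.card_ne_zero
  have hR0 : cfc Real.sqrt S * (1 - support S) = 0 := by
    rw [mul_sub, mul_one, sqrt_mul_support, sub_self]
  have hr : ∀ j, A j * support S = A j := fun j => by
    have h : S * (1 - support S) = 0 := by rw [mul_sub, mul_one, mul_support hS, sub_self]
    have := mul_eq_zero_of_sum_mul_eq_zero hA h j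
    rw [mul_sub, mul_one, sub_eq_zero] at this
    exact this.symm
  have hl : ∀ j, support S * A j = A j := fun j => by
    have := congrArg conjTranspose (hr j)
    rwa [conjTranspose_mul, (hA j).1.eq, (isHermitian_support S).eq] at this
  -- The first terms sum only to `support S`. The missing `1 - support S` is shared equally among
  -- the indices, and `√S` annihilates it.
  refine ⟨fun j => pinvSqrt S * A j * pinvSqrt S +
    (Fintype.card κ : ℂ)⁻¹ • (1 - support S), fun j => ?_, ?_, fun j => ?_⟩
  · refine .add ?_ ((posSemidef_one_sub_support S).smul (by positivity))
    have := (hA j).conjTranspose_mul_mul_same (pinvSqrt S)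
    rwa [(isHermitian_pinvSqrt S).eq] at this
  · rw [Finset.sum_add_distrib, ← Finset.sum_mul, ← Finset.mul_sum, ← hSdef, Finset.sum_const,
      Finset.card_univ, ← Nat.cast_smul_eq_nsmul ℂ, smul_smul, mul_inv_cancel₀ hk, one_smul]
    nth_rw 2 [← cfc_sqrt_mul_self hS]
    rw [← mul_assoc, pinvSqrt_mul_sqrt, mul_assoc, sqrt_mul_pinvSqrt, support_mul_self]
    abel
  · rw [mul_add, mul_smul_comm, hR0, smul_zero, add_zero, ← mul_assoc, ← mul_assoc,
      sqrt_mul_pinvSqrt, hl, mul_assoc, pinvSqrt_mul_sqrt, hr]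

end SquareRoot

/-! ### Density matrices and the projection in terms of blocks. -/

section Density

variable {q k : ℕ}

theorem frob_nonneg_of_posSemidef {ι : Type*} [Fintype ι] [DecidableEq ι] {A B : Matrix ι ι ℂ}
    (hA : A.PosSemidef) (hB : B.PosSemidef) : 0 ≤ frob A B := by
  rw [frob, hA.1.eq, ← cfc_sqrt_mul_self hA, mul_assoc, trace_mul_comm]
  have := (hB.conjTranspose_mul_mul_same (cfc Real.sqrt A)).trace_nonneg
  rwa [(isHermitian_cfc _ A).eq] at this

/-- Testing against the rank-one matrices `v v⋆` recovers the quadratic form of `A`. -/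
theorem posSemidef_of_frob_nonneg {A : Matrix (Fin q) (Fin q) ℂ} (hA : A.IsHermitian)
    (h : ∀ B : Matrix (Fin q) (Fin q) ℂ, B.PosSemidef → 0 ≤ frob A B) : A.PosSemidef := by
  refine .of_dotProduct_mulVec_nonneg hA fun v => ?_
  have := h _ (posSemidef_vecMulVec_self_star v)
  rwa [frob, hA.eq, mul_vecMulVec, trace_vecMulVec, dotProduct_comm] at this

theorem frob_blockDiagonal (A B : Fin k → Matrix (Fin q) (Fin q) ℂ) :
    frob (blockDiagonal A) (blockDiagonal B) = ∑ j, frob (A j) (B j) := by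
  rw [frob, blockDiagonal_conjTranspose, ← blockDiagonal_mul, trace_blockDiagonal]
  rfl

theorem posSemidef_blockDiagonal {A : Fin k → Matrix (Fin q) (Fin q) ℂ}
    (hA : ∀ j, (A j).PosSemidef) : (blockDiagonal A).PosSemidef := by
  have h := posSemidef_conjTranspose_mul_self (blockDiagonal fun j => cfc Real.sqrt (A j))
  rw [blockDiagonal_conjTranspose, ← blockDiagonal_mul] at h
  simpa only [(isHermitian_cfc _ _).eq, cfc_sqrt_mul_self (hA _)] using h

theorem blockDiagonal_mem_density {A : Fin k → Matrix (Fin q) (Fin q) ℂ}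
    (hA : ∀ j, (A j).PosSemidef) (htr : (∑ j, A j).trace = 1) :
    blockDiagonal A ∈ density (directSumAlg q k) :=
  ⟨⟨⟨⟨A, rfl⟩, (posSemidef_blockDiagonal hA).1⟩,
    fun _ hB => frob_nonneg_of_posSemidef (posSemidef_blockDiagonal hA) hB.2⟩, by
    rw [trace_blockDiagonal, ← trace_sum, htr]⟩

theorem exists_blocks_of_mem_density {M : Matrix (Fin q × Fin k) (Fin q × Fin k) ℂ}
    (hM : M ∈ density (directSumAlg q k)) :
    ∃ A : Fin k → Matrix (Fin q) (Fin q) ℂ, M = blockDiagonal A ∧ ∀ j, (A j).PosSemidef := by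
  obtain ⟨⟨⟨⟨A, rfl⟩, hh⟩, hpos⟩, -⟩ := hM
  refine ⟨A, rfl, fun j => posSemidef_of_frob_nonneg ?_ fun B hB => ?_⟩
  · rw [IsHermitian, blockDiagonal_conjTranspose] at hh
    exact congrFun (blockDiagonal_injective hh) j
  · have h := hpos (blockDiagonal (Pi.single j B)) ⟨⟨_, rfl⟩, posSemidef_blockDiagonal fun i => ?_⟩
    · rw [frob_blockDiagonal, Finset.sum_eq_single j] at h
      · simpa using h
      · intro i _ hi
        simp [frob, Pi.single_eq_of_ne hi]
      · simp
    · rcases eq_or_ne i j with rfl | hi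
      · simpa using hB
      · simpa [Pi.single_eq_of_ne hi] using PosSemidef.zero

/-- The multiple `k • B` is the sum of the equal blocks; it is the parameter in which the section is
written. -/
theorem exists_factor_of_mem_density {M : Matrix (Fin q × Fin k) (Fin q × Fin k) ℂ}
    (hM : M ∈ density (tensorOneAlg q k)) :
    ∃ B : Matrix (Fin q) (Fin q) ℂ, M = blockDiagonal (fun _ => B) ∧ (k • B).PosSemidef ∧
      (k • B).trace = 1 := by
  obtain ⟨⟨⟨⟨B, rfl⟩, hh⟩, hpos⟩, htr⟩ := hM
  simp only [kronecker_one] at *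
  rcases isEmpty_or_nonempty (Fin k) with hk | ⟨⟨j⟩⟩
  -- For `k = 0` the trace is `0`, so there are no density matrices.
  · simp at htr
  have hB : B.IsHermitian := by
    rw [IsHermitian, blockDiagonal_conjTranspose] at hh
    exact congrFun (blockDiagonal_injective hh) j
  refine ⟨B, rfl, posSemidef_of_frob_nonneg ?_ fun C hC => ?_, ?_⟩
  · rw [IsHermitian, conjTranspose_nsmul, hB.eq]
  · have h := hpos (blockDiagonal fun _ => C)
      ⟨⟨C, (kronecker_one C).symm⟩, posSemidef_blockDiagonal fun _ => hC⟩
    rw [frob_blockDiagonal] at h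
    simpa [frob, conjTranspose_nsmul, -nsmul_eq_mul] using h
  · simpa [trace_blockDiagonal, -nsmul_eq_mul] using htr

theorem orthProj_blockDiagonal {A : Fin k → Matrix (Fin q) (Fin q) ℂ}
    {B : Matrix (Fin q) (Fin q) ℂ} (h : ∑ j, A j = k • B) :
    orthProj (tensorOneAlg q k) (blockDiagonal A) = blockDiagonal fun _ => B := by
  refine (eq_orthProj (tensorOneAlg q k) (show _ ∈ tensorOneAlg q k from
    ⟨B, (kronecker_one B).symm⟩) ?_).symm
  rintro _ ⟨C, rfl⟩
  rw [kronecker_one, ← blockDiagonal_sub, frob_blockDiagonal]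
  simp only [frob, Pi.sub_apply]
  rw [← trace_sum, ← Finset.sum_mul, ← conjTranspose_sum, Finset.sum_sub_distrib, h]
  simp

theorem sum_blocks_eq_of_orthProj {A : Fin k → Matrix (Fin q) (Fin q) ℂ}
    {B : Matrix (Fin q) (Fin q) ℂ}
    (h : orthProj (tensorOneAlg q k) (blockDiagonal A) = blockDiagonal fun _ => B) :
    ∑ j, A j = k • B := by
  rcases isEmpty_or_nonempty (Fin k) with hk | ⟨⟨j⟩⟩
  · obtain rfl : k = 0 := (Fintype.card_fin k).symm.trans (Fintype.card_eq_zero_iff.2 hk)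
    simp
  have hk : (k : ℂ) ≠ 0 := Nat.cast_ne_zero.2 (Fin.pos j).ne'
  have hA : ∑ j, A j = k • ((k : ℂ)⁻¹ • ∑ j, A j) := by
    rw [← Nat.cast_smul_eq_nsmul ℂ, smul_smul, mul_inv_cancel₀ hk, one_smul]
  rw [orthProj_blockDiagonal hA] at h
  rwa [congrFun (blockDiagonal_injective h) j] at hA

end Density

/-- The block at position `j` of a matrix. -/
def block {q k : ℕ} (j : Fin k) (M : Matrix (Fin q × Fin k) (Fin q × Fin k) ℂ) :
    Matrix (Fin q) (Fin q) ℂ := M.submatrix (·, j) (·, j)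

theorem block_blockDiagonal {q k : ℕ} (j : Fin k) (A : Fin k → Matrix (Fin q) (Fin q) ℂ) :
    block j (blockDiagonal A) = A j := by
  ext a b
  simp [block, blockDiagonal_apply]

theorem block_properties {q k : ℕ} (j : Fin k)
    {M : Matrix (Fin q × Fin k) (Fin q × Fin k) ℂ} (hM : M ∈ density (tensorOneAlg q k)) :
    M = blockDiagonal (fun _ => block j M) ∧ (k • block j M).PosSemidef ∧
      (k • block j M).trace = 1 := by
  obtain ⟨B, rfl, h⟩ := exists_factor_of_mem_density hM
  rw [block_blockDiagonal]
  exact ⟨rfl, h⟩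

end MatrixState

open MatrixState Matrix in
theorem mainTheorem5 (q k : ℕ) :
    IsOpenMap (MatrixState.densityProj (MatrixState.tensorOneAlg_le q k) :
      MatrixState.density (MatrixState.directSumAlg q k) →
        MatrixState.density (MatrixState.tensorOneAlg q k)) := by
  refine .of_sections fun ⟨M, hM⟩ => ?_
  obtain ⟨A, rfl, hA⟩ := exists_blocks_of_mem_density hM
  rcases isEmpty_or_nonempty (Fin k) with hk | hk
  · have := hM.2
    simp at this
  obtain ⟨E, hE, hE1, hEA⟩ := exists_resolution_of_sum hA
  -- Any block will do, since the blocks of an element of `tensorOneAlg q k` coincide.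
  let j₀ : Fin k := Classical.arbitrary _
  let R : density (tensorOneAlg q k) → Matrix (Fin q) (Fin q) ℂ :=
    fun T => cfc Real.sqrt (k • block j₀ T.1)
  have hsum : ∀ T, ∑ j, R T * E j * R T = k • block j₀ T.1 := fun T => by
    rw [← Finset.sum_mul, ← Finset.mul_sum, hE1, mul_one,
      cfc_sqrt_mul_self (block_properties j₀ T.2).2.1]
  have hmem : ∀ T, blockDiagonal (fun j => R T * E j * R T) ∈ density (directSumAlg q k) := by
    refine fun T => blockDiagonal_mem_density (fun j => ?_) ?_
    · have := (hE j).conjTranspose_mul_mul_same (R T)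
      rwa [(isHermitian_cfc _ _).eq] at this
    · rw [hsum, (block_properties j₀ T.2).2.2]
  have hR : Continuous R := by
    refine continuousOn_cfc_sqrt.comp_continuous ?_ fun T => (block_properties j₀ T.2).2.1.1
    exact (continuous_subtype_val.matrix_submatrix _ _).const_smul k
  refine ⟨fun T => ⟨_, hmem T⟩, Continuous.continuousAt ?_, ?_, fun T => ?_⟩
  · refine Continuous.subtype_mk (Continuous.matrix_blockDiagonal ?_) _
    exact continuous_pi fun j => (hR.mul continuous_const).mul hR
  -- At the image of the base point, `k • block j₀` is `∑ j, A j`, so the section returns the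
  -- original blocks.
  · have hB := (block_properties j₀ (densityProj (tensorOneAlg_le q k) ⟨_, hM⟩).2).1
    have hS := sum_blocks_eq_of_orthProj hB
    rw [hS] at hEA
    exact Subtype.ext (congrArg blockDiagonal (funext hEA))
  · exact Subtype.ext
      ((orthProj_blockDiagonal (hsum T)).trans (block_properties j₀ T.2).1.symm)
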